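/- For positive integers $k,k_1,k_2$ and roots of unity $x,x_1,x_2\in\mathbb{C}$ with $(k,x)\neq(1,1)$ and $(k_2,x_2)\ne(1,1)$, write $$\mathrm{Li}_k(x)=\sum_{n\ge 1}\frac{x^n}{n^k}=\lim_{N\to\infty}\sum_{0<n\le N}\frac{x^n}{n^k},\qquad \mathrm{Li}_{k_1,k_2}(x_1,x_2)=\sum_{0<n_1<n_2}\frac{x_1^{n_1}x_2^{n_2}}{n_1^{k_1}n_2^{k_2}}=\lim_{N\to\infty}\sum_{0<n_1<n_2\le N}\frac{x_1^{n_1}x_2^{n_2}}{n_1^{k_1}n_2^{k_2}}.$$ For a root of unity $z$ and an integer $l\ge 0$ put $E_l(z)=(-1)^l\,\mathrm{Li}_l(1/z)+\mathrm{Li}_l(z)$, where for $l=0$ this is read as $E_0(z)=-1$ (the convention $\mathrm{Li}_0(z)+\mathrm{Li}_0(1/z)=-1$), and for $l=1$, $z=1$ (where the same divergent series is subtracted from itself) as $E_1(1)=0$. Let $x,y$ be roots of unity and let $q,k$ be positive integers with $(q,x)\neq(1,1)$ and $(k,y)\ne(1,1)$. Then all the limits $\mathrm{Li}$ that occur below exist,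 and $$\begin{aligned} &\mathrm{Li}_{k,q}(y,x)-(-1)^{q+k}\,\mathrm{Li}_{k,q}\!\left(\tfrac1y,\tfrac1x\right)\\ &\quad=\mathrm{Li}_q(x)\,\mathrm{Li}_k(y)+(-1)^q\,\mathrm{Li}_k(y)\,\mathrm{Li}_q\!\left(\tfrac1x\right)-\mathrm{Li}_{k+q}(xy)\\ &\qquad-(-1)^q\sum_{l=0}^{k}\binom{q+k-l-1}{q-1}E_l(xy)\,\mathrm{Li}_{q+k-l}\!\left(\tfrac1x\right)\\ &\qquad-(-1)^q\sum_{l=0}^{q}(-1)^l\binom{q+k-l-1}{k-1}E_l(xy)\,\mathrm{Li}_{q+k-l}(y). \end{aligned}$$ Moreover, the limit $\mathrm{Li}_j(z)$ exists for every integer $j\ge1$ and every root of unity $z$ with $(j,z)\ne(1,1)$. -/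

import Mathlib

open Filter Topology

noncomputable section

/-- Partial sums `∑_{0 < n ≤ N} x ^ n / n ^ k` of the depth one cyclotomic value. -/
def cycloSum (k : ℕ) (x : ℂ) (N : ℕ) : ℂ :=
  ∑ n ∈ Finset.Icc 1 N, x ^ n / (n : ℂ) ^ k

/-- Partial sums `∑_{0 < n₁ < n₂ ≤ N} x₁ ^ n₁ x₂ ^ n₂ / (n₁ ^ k₁ n₂ ^ k₂)` of the
depth two cyclotomic value. -/
def cycloDoubleSum (k₁ k₂ : ℕ) (x₁ x₂ : ℂ) (N : ℕ) : ℂ :=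
  ∑ n₂ ∈ Finset.Icc 1 N, ∑ n₁ ∈ Finset.Ico 1 n₂,
    x₁ ^ n₁ * x₂ ^ n₂ / ((n₁ : ℂ) ^ k₁ * (n₂ : ℂ) ^ k₂)

/-- `Li_k(x)`, the limit of the partial sums. The series may converge only conditionally
(when `k = 1`), so it is not a `tsum`. -/
def cycloLi (k : ℕ) (x : ℂ) : ℂ :=
  limUnder atTop (cycloSum k x)

/-- `Li_{k₁,k₂}(x₁,x₂)`, the limit of the partial sums. -/
def cycloDoubleLi (k₁ k₂ : ℕ) (x₁ x₂ : ℂ) : ℂ :=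
  limUnder atTop (cycloDoubleSum k₁ k₂ x₁ x₂)

/-- The bracket `(-1)^l Li_l(1/z) + Li_l(z)`. For `l = 0` it is `-1`, by the convention
`Li_0(z) + Li_0(1/z) = -1`. For `l = 1` and `z = 1` it is the formal difference
`-Li_1(1) + Li_1(1)` of twice the same divergent series, and its value is `0`. -/
def cycloBracket (l : ℕ) (z : ℂ) : ℂ :=
  open Classical in
  if l = 0 then -1
  else if l = 1 ∧ z = 1 then 0
  else (-1) ^ l * cycloLi l z⁻¹ + cycloLi l z

end

/-! Evaluate in two ways the sum of `y^a x^c / (a^k c^q)` over integers `c < a` in `[-N, N]`, terms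
with a zero denominator counting as `0`, and let `N` grow.

Splitting by the signs of `a` and `c` (`sum_lt_Icc_neg_eq`) gives products of depth one sums, a
diagonal, and the two double sums; the one from negative indices carries `(-1)^(q+k)` and inverted
arguments.

Fixing `b = a - c` instead, partial fractions in `a` (`cycloTerm_mul_cycloTerm_sub`) separate a
power of `1/b` from a power of `1/a` or `1/(b-a)`. Summing over `a` leaves sums over `b` of a depth
one term times a window sum over `[b-N, N]`. For fixed `b` the window sum tends to `E_l`, and
`tendsto_sum_cycloTerm_mul_cycloWindow` shows that the limit may be taken inside the sum over `b`.
The corrections at `a = 0` and `a = b` are the `l = 0` terms, whence `E_0 = -1`. -/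

/-! ### Partial fractions and binomial coefficients -/

/-- The partial fraction expansion of `A ^ (m + 1) * C ^ (p + 1)` where `A = 1 / a`, `C = 1 / c`
and `W = 1 / (a + c)`. -/
theorem inv_pow_mul_inv_pow_eq {R : Type*} [CommRing R] {A C W : R} (h : A * C = W * (A + C))
    (m p : ℕ) :
    A ^ (m + 1) * C ^ (p + 1) =
      ∑ ij ∈ Finset.HasAntidiagonal.antidiagonal m, ((p + ij.2).choose ij.2 : R) * (A ^ (ij.1 + 1) * W ^ (p + 1 + ij.2)) +
      ∑ ij ∈ Finset.HasAntidiagonal.antidiagonal p,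
        ((m + ij.2).choose ij.2 : R) * (C ^ (ij.1 + 1) * W ^ (m + 1 + ij.2)) := by
  have base : ∀ {A C : R}, A * C = W * (A + C) → ∀ p : ℕ, A * C ^ (p + 1) =
      A * W ^ (p + 1) + ∑ ij ∈ Finset.HasAntidiagonal.antidiagonal p, C ^ (ij.1 + 1) * W ^ (1 + ij.2) := by
    intro A C h p
    induction p with
    | zero => simp [h]; ring
    | succ p ih =>
      rw [Finset.Nat.sum_antidiagonal_succ']
      have e : ∑ ij ∈ Finset.HasAntidiagonal.antidiagonal p, C ^ (ij.1 + 1) * W ^ (1 + (ij.2 + 1)) =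
          W * ∑ ij ∈ Finset.HasAntidiagonal.antidiagonal p, C ^ (ij.1 + 1) * W ^ (1 + ij.2) := by
        rw [Finset.mul_sum]
        exact Finset.sum_congr rfl fun _ _ => by ring
      rw [e]
      linear_combination C ^ (p + 1) * h + W * ih
  -- By Pascal's rule each sum on the right obeys the recursion that `A * C = W * (A + C)` imposes
  -- on the left side, so a double induction applies.
  have step : ∀ (A : R) (m p : ℕ),
      ∑ ij ∈ Finset.HasAntidiagonal.antidiagonal (m + 1),
        ((p + 1 + ij.2).choose ij.2 : R) * (A ^ (ij.1 + 1) * W ^ (p + 1 + 1 + ij.2)) =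
      W * (∑ ij ∈ Finset.HasAntidiagonal.antidiagonal m,
        ((p + 1 + ij.2).choose ij.2 : R) * (A ^ (ij.1 + 1) * W ^ (p + 1 + 1 + ij.2)) +
        ∑ ij ∈ Finset.HasAntidiagonal.antidiagonal (m + 1),
          ((p + ij.2).choose ij.2 : R) * (A ^ (ij.1 + 1) * W ^ (p + 1 + ij.2))) := by
    intro A m p
    rw [Finset.Nat.sum_antidiagonal_succ', Finset.Nat.sum_antidiagonal_succ']
    simp only [mul_add W, Finset.mul_sum, Nat.choose_zero_right, add_zero]
    rw [add_left_comm, ← Finset.sum_add_distrib]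
    congr 1
    · ring
    · refine Finset.sum_congr rfl fun ij _ => ?_
      rw [show p + 1 + (ij.2 + 1) = (p + 1 + ij.2) + 1 by ring, Nat.choose_succ_succ,
        show p + (ij.2 + 1) = p + 1 + ij.2 by ring]
      push_cast
      ring
  induction m generalizing p with
  | zero => simpa using base h p
  | succ m ihm =>
    induction p with
    | zero =>
      have h' : C * A = W * (C + A) := by linear_combination h
      have := base h' (m + 1)
      simp only [zero_add, pow_one, Nat.choose_self, Nat.cast_one, one_mul, Finset.Nat.antidiagonal_zero,
        Finset.sum_singleton, Nat.choose_zero_right, add_zero]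
      rw [mul_comm, this]
      ring
    | succ p ihp =>
      rw [step A m p, step C p m]
      linear_combination A ^ (m + 1) * C ^ (p + 1) * h + W * ihm (p + 1) + W * ihp

/-- Hockey-stick identity. It totals the partial fraction coefficients at the two exceptional
points, where all the monomials coincide. -/
theorem sum_antidiagonal_add_choose (m p : ℕ) :
    ∑ ij ∈ Finset.HasAntidiagonal.antidiagonal p, (m + ij.2).choose ij.2 = (m + p + 1).choose p := by
  induction p with
  | zero => simp
  | succ p ih =>
    rw [Finset.Nat.sum_antidiagonal_succ, ih, ← add_assoc, Nat.choose_succ_succ' (m + p + 1) p,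
      add_comm, add_assoc]

/-! ### Finite sums over pairs of integers -/

/-- The general term `x ^ n / n ^ k` over the integers. It vanishes at `n = 0` if `k ≠ 0`. -/
noncomputable def cycloTerm (k : ℕ) (x : ℂ) (n : ℤ) : ℂ := x ^ n / (n : ℂ) ^ k

theorem cycloTerm_zero {k : ℕ} (hk : k ≠ 0) (x : ℂ) : cycloTerm k x 0 = 0 := by
  simp [cycloTerm, hk]

theorem cycloTerm_neg (k : ℕ) (x : ℂ) (n : ℤ) :
    cycloTerm k x (-n) = (-1) ^ k * cycloTerm k x⁻¹ n := by
  have : (-(n : ℂ)) ^ k = (-1) ^ k * (n : ℂ) ^ k := by rw [← mul_pow]; simp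
  simp only [cycloTerm, Int.cast_neg, this, zpow_neg, inv_zpow]
  rcases neg_one_pow_eq_or ℂ k with h | h <;> rw [h] <;> simp [div_neg]

theorem norm_cycloTerm_le {k : ℕ} (hk : k ≠ 0) {x : ℂ} (hx : ‖x‖ = 1) (n : ℤ) :
    ‖cycloTerm k x n‖ ≤ 1 / |(n : ℝ)| := by
  rcases eq_or_ne n 0 with rfl | hn
  · simp [cycloTerm_zero hk]
  have h1 : (1 : ℝ) ≤ |(n : ℝ)| := by exact_mod_cast Int.one_le_abs hn
  simp only [cycloTerm, norm_div, norm_zpow, hx, one_zpow, norm_pow, Complex.norm_intCast]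
  gcongr
  exact le_self_pow₀ h1 hk

theorem cycloSum_eq (k : ℕ) (x : ℂ) (N : ℕ) :
    cycloSum k x N = ∑ n ∈ Finset.Icc 1 N, cycloTerm k x n := by
  simp [cycloSum, cycloTerm]

theorem sum_Icc_neg_succ {M : Type*} [AddCommGroup M] (f : ℤ → M) (N : ℕ) :
    ∑ n ∈ Finset.Icc (-((N + 1 : ℕ) : ℤ)) ((N + 1 : ℕ) : ℤ), f n =
      f (-((N + 1 : ℕ) : ℤ)) + ∑ n ∈ Finset.Icc (-(N : ℤ)) N, f n + f ((N + 1 : ℕ) : ℤ) := by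
  have : Finset.Icc (-((N + 1 : ℕ) : ℤ)) ((N + 1 : ℕ) : ℤ) =
      insert (-((N + 1 : ℕ) : ℤ)) (insert ((N + 1 : ℕ) : ℤ) (Finset.Icc (-(N : ℤ)) N)) := by
    ext n
    simp only [Finset.mem_insert, Finset.mem_Icc]
    omega
  rw [this, Finset.sum_insert, Finset.sum_insert]
  · abel
  · simp
  · simp only [Finset.mem_insert, Finset.mem_Icc]
    omega

theorem sum_Icc_neg_eq {M : Type*} [AddCommGroup M] {f : ℤ → M} (hf : f 0 = 0) (N : ℕ) :
    ∑ n ∈ Finset.Icc (-(N : ℤ)) N, f n =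
      ∑ n ∈ Finset.Icc 1 N, f n + ∑ n ∈ Finset.Icc 1 N, f (-(n : ℤ)) := by
  induction N with
  | zero => simp [hf]
  | succ N ih =>
    rw [sum_Icc_neg_succ, ih, Finset.sum_Icc_succ_top (by omega),
      Finset.sum_Icc_succ_top (by omega)]
    abel

/-- The sum over pairs `c < a` in `[-N, N]`, split by the signs of `a` and `c`. -/
theorem sum_lt_Icc_neg_eq {f g : ℤ → ℂ} (hf : f 0 = 0) (hg : g 0 = 0) (N : ℕ) :
    ∑ a ∈ Finset.Icc (-(N : ℤ)) N, ∑ c ∈ Finset.Ico (-(N : ℤ)) a, f a * g c =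
      (∑ n ∈ Finset.Icc 1 N, f n) * (∑ n ∈ Finset.Icc 1 N, g n)
      + (∑ n ∈ Finset.Icc 1 N, f n) * (∑ n ∈ Finset.Icc 1 N, g (-(n : ℤ)))
      - ∑ n ∈ Finset.Icc 1 N, f n * g n
      - ∑ n ∈ Finset.Icc 1 N, ∑ i ∈ Finset.Ico 1 n, f i * g n
      + ∑ n ∈ Finset.Icc 1 N, ∑ i ∈ Finset.Ico 1 n, f (-(i : ℤ)) * g (-(n : ℤ)) := by
  induction N with
  | zero => simp [hf]
  | succ N ih =>
    -- Enlarging `N` adds the column `c = -(N+1)` (`e1`) and the row `a = N+1` (`e2`); the row `a =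
    -- -(N+1)` is empty.
    have e1 : ∀ a ∈ Finset.Icc (-(N : ℤ)) N,
        ∑ c ∈ Finset.Ico (-((N + 1 : ℕ) : ℤ)) a, f a * g c =
          f a * g (-((N + 1 : ℕ) : ℤ)) + ∑ c ∈ Finset.Ico (-(N : ℤ)) a, f a * g c := by
      intro a ha
      rw [Finset.mem_Icc] at ha
      have : Finset.Ico (-((N + 1 : ℕ) : ℤ)) a =
          insert (-((N + 1 : ℕ) : ℤ)) (Finset.Ico (-(N : ℤ)) a) := by
        ext n
        simp only [Finset.mem_insert, Finset.mem_Ico]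
        omega
      rw [this, Finset.sum_insert]
      simp
    have e2 : ∑ c ∈ Finset.Ico (-((N + 1 : ℕ) : ℤ)) ((N + 1 : ℕ) : ℤ), f ((N + 1 : ℕ) : ℤ) * g c =
        f ((N + 1 : ℕ) : ℤ) * (g (-((N + 1 : ℕ) : ℤ)) + ∑ c ∈ Finset.Icc (-(N : ℤ)) N, g c) := by
      have : Finset.Ico (-((N + 1 : ℕ) : ℤ)) ((N + 1 : ℕ) : ℤ) =
          insert (-((N + 1 : ℕ) : ℤ)) (Finset.Icc (-(N : ℤ)) N) := by
        ext n
        simp only [Finset.mem_insert, Finset.mem_Ico, Finset.mem_Icc]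
        omega
      rw [this, Finset.sum_insert (by simp), ← Finset.mul_sum, mul_add]
    have e3 : Finset.Ico 1 (N + 1) = Finset.Icc 1 N := by
      ext; simp only [Finset.mem_Ico, Finset.mem_Icc]; omega
    rw [sum_Icc_neg_succ, Finset.sum_congr rfl e1, e2, Finset.sum_add_distrib, ih,
      ← Finset.sum_mul, sum_Icc_neg_eq hf, sum_Icc_neg_eq hg]
    simp only [Finset.sum_Icc_succ_top (show 1 ≤ N + 1 by omega), e3, Finset.Ico_self,
      Finset.sum_empty, ← Finset.sum_mul]
    ring

/-- The sum over pairs `c < a` in `[-N, N]`, arranged by the difference `b = a - c`. -/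
theorem sum_lt_Icc_neg_eq_sum_sub {M : Type*} [AddCommMonoid M] (φ : ℤ → ℤ → M) (N : ℕ) :
    ∑ a ∈ Finset.Icc (-(N : ℤ)) N, ∑ c ∈ Finset.Ico (-(N : ℤ)) a, φ a c =
      ∑ b ∈ Finset.Icc 1 (2 * N), ∑ a ∈ Finset.Icc ((b : ℤ) - N) N, φ a (a - b) := by
  rw [Finset.sum_sigma', Finset.sum_sigma']
  refine Finset.sum_nbij' (fun t => ⟨(t.1 - t.2).toNat, t.1⟩) (fun t => ⟨t.2, t.2 - t.1⟩) ?_ ?_ ?_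
    ?_ ?_
  · rintro ⟨a, c⟩ h
    simp only [Finset.mem_sigma, Finset.mem_Icc, Finset.mem_Ico] at h ⊢
    omega
  · rintro ⟨b, a⟩ h
    simp only [Finset.mem_sigma, Finset.mem_Icc, Finset.mem_Ico] at h ⊢
    omega
  · rintro ⟨a, c⟩ h
    simp only [Finset.mem_sigma, Finset.mem_Icc, Finset.mem_Ico] at h ⊢
    simp only [Sigma.mk.injEq, heq_eq_eq, true_and]
    omega
  · rintro ⟨b, a⟩ h
    simp
  · rintro ⟨a, c⟩ h
    simp only [Finset.mem_sigma, Finset.mem_Icc, Finset.mem_Ico] at h ⊢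
    have : a - ((a - c).toNat : ℤ) = c := by omega
    rw [this]

/-! ### Window sums and the expansion by differences -/

/-- The window sum `∑ z ^ a / a ^ l` over `b - N ≤ a ≤ N`. -/
noncomputable def cycloWindow (l : ℕ) (z : ℂ) (N b : ℕ) : ℂ :=
  ∑ a ∈ Finset.Icc ((b : ℤ) - N) N, cycloTerm l z a

/-- Partial fractions for a product of two terms. The last two summands account for the
vanishing denominators at `a = 0` and `a = b`. -/
theorem cycloTerm_mul_cycloTerm_sub {x y : ℂ} (hx : x ≠ 0) (hy : y ≠ 0) (m p : ℕ) {b : ℕ}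
    (hb : b ≠ 0) (a : ℤ) :
    (-1) ^ (p + 1) * (cycloTerm (m + 1) y a * cycloTerm (p + 1) x (a - b)) =
      ∑ ij ∈ Finset.HasAntidiagonal.antidiagonal m, ((p + ij.2).choose ij.2 : ℂ) *
        (cycloTerm (p + 1 + ij.2) x⁻¹ b * cycloTerm (ij.1 + 1) (x * y) a) +
      ∑ ij ∈ Finset.HasAntidiagonal.antidiagonal p, ((m + ij.2).choose ij.2 : ℂ) *
        (cycloTerm (m + 1 + ij.2) y b * cycloTerm (ij.1 + 1) (x * y)⁻¹ (b - a))
      - (if a = 0 then ((m + p + 1).choose p : ℂ) * cycloTerm (m + p + 2) x⁻¹ b else 0)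
      - (if a = b then ((m + p + 1).choose m : ℂ) * cycloTerm (m + p + 2) y b else 0) := by
  set u : ℂ := y ^ a * x ^ (a - b) with hu
  set A : ℂ := (a : ℂ)⁻¹ with hA
  set W : ℂ := (b : ℂ)⁻¹ with hW
  set C : ℂ := ((b : ℂ) - a)⁻¹ with hC
  have hb' : (b : ℂ) ≠ 0 := Nat.cast_ne_zero.2 hb
  have u1 : x⁻¹ ^ (b : ℤ) * (x * y) ^ a = u := by
    rw [hu, mul_zpow, zpow_sub₀ hx, inv_zpow]; field_simp
  have u2 : y ^ (b : ℤ) * (x * y)⁻¹ ^ ((b : ℤ) - a) = u := by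
    rw [hu, inv_zpow, mul_zpow, zpow_sub₀ hx, zpow_sub₀ hx, zpow_sub₀ hy]; field_simp
  have s1 : ∀ ij : ℕ × ℕ, ((p + ij.2).choose ij.2 : ℂ) *
        (cycloTerm (p + 1 + ij.2) x⁻¹ b * cycloTerm (ij.1 + 1) (x * y) a) =
      u * (((p + ij.2).choose ij.2 : ℂ) * (A ^ (ij.1 + 1) * W ^ (p + 1 + ij.2))) := by
    intro ij
    simp only [cycloTerm, ← u1, hA, hW, div_eq_mul_inv, inv_pow, Int.cast_natCast]
    ring
  have s2 : ∀ ij : ℕ × ℕ, ((m + ij.2).choose ij.2 : ℂ) *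
        (cycloTerm (m + 1 + ij.2) y b * cycloTerm (ij.1 + 1) (x * y)⁻¹ (b - a)) =
      u * (((m + ij.2).choose ij.2 : ℂ) * (C ^ (ij.1 + 1) * W ^ (m + 1 + ij.2))) := by
    intro ij
    simp only [cycloTerm, ← u2, hC, hW, div_eq_mul_inv, inv_pow, Int.cast_natCast, Int.cast_sub]
    ring
  have s3 : (-1) ^ (p + 1) * (cycloTerm (m + 1) y a * cycloTerm (p + 1) x (a - b)) =
      u * (A ^ (m + 1) * C ^ (p + 1)) := by
    have : C = -((a : ℂ) - b)⁻¹ := by rw [hC, ← inv_neg, neg_sub]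
    rw [this, neg_pow (((a : ℂ) - b)⁻¹)]
    simp only [cycloTerm, hu, hA, div_eq_mul_inv, inv_pow, Int.cast_natCast, Int.cast_sub]
    ring
  have hsum : ∀ m p : ℕ, ∀ D : ℂ, D = W →
      ∑ ij ∈ Finset.HasAntidiagonal.antidiagonal p,
        ((m + ij.2).choose ij.2 : ℂ) * (D ^ (ij.1 + 1) * W ^ (m + 1 + ij.2)) =
      ((m + p + 1).choose p : ℂ) * W ^ (m + p + 2) := by
    rintro m p D rfl
    rw [← sum_antidiagonal_add_choose, Nat.cast_sum, Finset.sum_mul]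
    refine Finset.sum_congr rfl fun ij h => ?_
    rw [Finset.HasAntidiagonal.mem_antidiagonal] at h
    rw [← h, ← pow_add]
    ring_nf
  simp only [s1, s2, s3, ← Finset.mul_sum]
  -- Since `0⁻¹ = 0`, at `a = 0` the left side and the sum in `A` vanish, but `C = W` leaves a
  -- multiple of `W ^ (m + p + 2)`, which the correction removes. At `a = b` the roles of `A` and
  -- `C` are exchanged.
  rcases eq_or_ne a 0 with ha | ha
  · have hA0 : A = 0 := by simp [hA, ha]
    have hCW : C = W := by simp [hC, hW, ha]
    have hab : a ≠ b := by omega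
    have hux : u = x⁻¹ ^ (b : ℤ) := by rw [← u1, ha]; simp
    rw [if_pos ha, if_neg hab, hsum m p C hCW, hux]
    simp [hA0, cycloTerm, hW, div_eq_mul_inv]
    ring
  rcases eq_or_ne a b with hab | hab
  · have hC0 : C = 0 := by simp [hC, hab]
    have hAW : A = W := by simp [hA, hW, hab]
    have huy : u = y ^ (b : ℤ) := by rw [← u2, hab]; simp
    rw [if_neg ha, if_pos hab, hsum p m A hAW, huy, add_comm p m]
    simp [hC0, cycloTerm, hW, div_eq_mul_inv]
    ring
  · have ha' : (a : ℂ) ≠ 0 := Int.cast_ne_zero.2 ha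
    have hc' : (b : ℂ) - a ≠ 0 := by
      rw [sub_ne_zero]
      exact_mod_cast hab.symm
    have h : A * C = W * (A + C) := by
      rw [hA, hC, hW]
      field_simp
      ring
    rw [if_neg ha, if_neg hab, inv_pow_mul_inv_pow_eq h]
    ring

theorem sum_lt_cycloTerm_eq_sum_window {x y : ℂ} (hx : x ≠ 0) (hy : y ≠ 0) (m p N : ℕ) :
    (-1) ^ (p + 1) * ∑ a ∈ Finset.Icc (-(N : ℤ)) N, ∑ c ∈ Finset.Ico (-(N : ℤ)) a,
        cycloTerm (m + 1) y a * cycloTerm (p + 1) x c =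
      ∑ ij ∈ Finset.HasAntidiagonal.antidiagonal m, ((p + ij.2).choose ij.2 : ℂ) *
        ∑ b ∈ Finset.Icc 1 (2 * N),
          cycloTerm (p + 1 + ij.2) x⁻¹ b * cycloWindow (ij.1 + 1) (x * y) N b +
      ∑ ij ∈ Finset.HasAntidiagonal.antidiagonal p, ((m + ij.2).choose ij.2 : ℂ) *
        ∑ b ∈ Finset.Icc 1 (2 * N),
          cycloTerm (m + 1 + ij.2) y b * cycloWindow (ij.1 + 1) (x * y)⁻¹ N b
      - ((m + p + 1).choose p : ℂ) * cycloSum (m + p + 2) x⁻¹ N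
      - ((m + p + 1).choose m : ℂ) * cycloSum (m + p + 2) y N := by
  have key : ∀ b ∈ Finset.Icc 1 (2 * N), (-1) ^ (p + 1) * ∑ a ∈ Finset.Icc ((b : ℤ) - N) N,
        cycloTerm (m + 1) y a * cycloTerm (p + 1) x (a - b) =
      ∑ ij ∈ Finset.HasAntidiagonal.antidiagonal m, ((p + ij.2).choose ij.2 : ℂ) *
          (cycloTerm (p + 1 + ij.2) x⁻¹ b * cycloWindow (ij.1 + 1) (x * y) N b) +
      ∑ ij ∈ Finset.HasAntidiagonal.antidiagonal p, ((m + ij.2).choose ij.2 : ℂ) *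
          (cycloTerm (m + 1 + ij.2) y b * cycloWindow (ij.1 + 1) (x * y)⁻¹ N b)
      - (if b ≤ N then ((m + p + 1).choose p : ℂ) * cycloTerm (m + p + 2) x⁻¹ b else 0)
      - (if b ≤ N then ((m + p + 1).choose m : ℂ) * cycloTerm (m + p + 2) y b else 0) := by
    intro b hb
    rw [Finset.mem_Icc] at hb
    -- The reflection `a ↦ b - a` maps the window `[b-N, N]` to itself.
    have r : ∀ l, cycloWindow l (x * y)⁻¹ N b =
        ∑ a ∈ Finset.Icc ((b : ℤ) - N) N, cycloTerm l (x * y)⁻¹ (b - a) := by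
      intro l
      refine Finset.sum_nbij' (fun a => b - a) (fun a => b - a) ?_ ?_ ?_ ?_ ?_ <;> intro a ha
      · rw [Finset.mem_Icc] at ha ⊢; omega
      · rw [Finset.mem_Icc] at ha ⊢; omega
      · simp
      · simp
      · simp
    rw [Finset.mul_sum, Finset.sum_congr rfl fun a _ =>
      cycloTerm_mul_cycloTerm_sub hx hy m p (by omega : b ≠ 0) a]
    simp only [r]
    simp only [cycloWindow, Finset.sum_sub_distrib, Finset.sum_add_distrib, Finset.mul_sum]
    rw [Finset.sum_comm, Finset.sum_comm (t := Finset.HasAntidiagonal.antidiagonal p), Finset.sum_ite_eq',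
      Finset.sum_ite_eq']
    have e1 : (0 : ℤ) ∈ Finset.Icc ((b : ℤ) - N) N ↔ b ≤ N := by rw [Finset.mem_Icc]; omega
    have e2 : (b : ℤ) ∈ Finset.Icc ((b : ℤ) - N) N ↔ b ≤ N := by rw [Finset.mem_Icc]; omega
    simp only [e1, e2]
  -- The points `a = 0` and `a = b` lie in the window exactly when `b ≤ N`, which cuts the
  -- correction sums off at `N` instead of `2N`.
  have hcut : ∀ (c : ℂ) (k : ℕ) (z : ℂ),
      ∑ b ∈ Finset.Icc 1 (2 * N), (if b ≤ N then c * cycloTerm k z b else 0) =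
        c * cycloSum k z N := by
    intro c k z
    rw [cycloSum_eq, Finset.mul_sum, ← Finset.sum_filter]
    refine Finset.sum_congr ?_ fun _ _ => rfl
    ext
    simp only [Finset.mem_filter, Finset.mem_Icc]
    omega
  rw [sum_lt_Icc_neg_eq_sum_sub (fun a c => cycloTerm (m + 1) y a * cycloTerm (p + 1) x c),
    Finset.mul_sum, Finset.sum_congr rfl key]
  simp only [Finset.sum_sub_distrib, Finset.sum_add_distrib, hcut]
  rw [Finset.sum_comm, Finset.sum_comm (t := Finset.HasAntidiagonal.antidiagonal p)]
  simp only [Finset.mul_sum]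

/-! ### Convergence and tails of the depth one series -/

theorem one_div_sq_le {n : ℕ} (hn : 1 ≤ n) :
    1 / (n : ℝ) ^ 2 ≤ 2 * (1 / (n : ℝ) - 1 / ((n + 1 : ℕ) : ℝ)) := by
  have h : (1 : ℝ) ≤ n := by exact_mod_cast hn
  have e : 2 * (1 / (n : ℝ) - 1 / ((n + 1 : ℕ) : ℝ)) = 2 / (n * (n + 1)) := by
    push_cast
    field_simp
    ring
  rw [e, div_le_div_iff₀ (by positivity) (by positivity)]
  nlinarith

/-- For `j ≥ 2` compare with the telescoping bound for `1 / n^2`; for `j = 1` sum by parts, using `z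
≠ 1`. Uniformity in `M` yields both convergence and the `O(1 / b)` tails. -/
theorem exists_norm_sum_Ico_cycloTerm_le {j : ℕ} (hj : 1 ≤ j) {z : ℂ} (hz : ‖z‖ = 1)
    (hjz : ¬(j = 1 ∧ z = 1)) :
    ∃ C : ℝ, 0 ≤ C ∧ ∀ b M : ℕ, 1 ≤ b → b ≤ M →
      ‖∑ n ∈ Finset.Ico b M, cycloTerm j z n‖ ≤ C / b := by
  rcases eq_or_ne j 1 with rfl | hj1
  · have hz1 : z - 1 ≠ 0 := sub_ne_zero.2 fun h => hjz ⟨rfl, h⟩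
    -- The difference inside the norm is the sum of `z^(n+1) (1/n - 1/(n+1))`, whose norms
    -- telescope.
    have key : ∀ b M : ℕ, 1 ≤ b → b ≤ M →
        ‖(z - 1) * ∑ n ∈ Finset.Ico b M, cycloTerm 1 z n - (z ^ M / M - z ^ b / b)‖ ≤
          1 / (b : ℝ) - 1 / (M : ℝ) := by
      intro b M hb hM
      induction M, hM using Nat.le_induction with
      | base => simp
      | succ M hM ih =>
        have hM0 : (M : ℂ) ≠ 0 := Nat.cast_ne_zero.2 (by omega)
        have hM1 : (M : ℂ) + 1 ≠ 0 := by exact_mod_cast Nat.succ_ne_zero M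
        have e : (z - 1) * ∑ n ∈ Finset.Ico b (M + 1), cycloTerm 1 z n -
            (z ^ (M + 1) / ((M + 1 : ℕ) : ℂ) - z ^ b / b) =
            ((z - 1) * ∑ n ∈ Finset.Ico b M, cycloTerm 1 z n - (z ^ M / M - z ^ b / b)) +
              z ^ (M + 1) * ((1 / (M : ℝ) - 1 / ((M + 1 : ℕ) : ℝ) : ℝ) : ℂ) := by
          rw [Finset.sum_Ico_succ_top hM]
          simp only [cycloTerm, zpow_natCast, Int.cast_natCast, pow_one]
          push_cast
          field_simp
          ring
        have hnn : 0 ≤ 1 / (M : ℝ) - 1 / ((M + 1 : ℕ) : ℝ) := by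
          have : (0 : ℝ) < M := by exact_mod_cast (by omega : 0 < M)
          rw [sub_nonneg]
          gcongr
          simp
        rw [e]
        refine (norm_add_le _ _).trans ?_
        rw [norm_mul, norm_pow, hz, one_pow, one_mul, Complex.norm_real, Real.norm_of_nonneg hnn]
        linarith
    refine ⟨2 / ‖z - 1‖, by positivity, fun b M hb hM => ?_⟩
    have h := key b M hb hM
    have hM' : ‖z ^ M / (M : ℂ) - z ^ b / b‖ ≤ 1 / (M : ℝ) + 1 / (b : ℝ) := by
      refine (norm_sub_le _ _).trans ?_
      simp [hz]
    have h2 : ‖(z - 1) * ∑ n ∈ Finset.Ico b M, cycloTerm 1 z n‖ ≤ 2 / b := by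
      have := norm_add_le ((z - 1) * ∑ n ∈ Finset.Ico b M, cycloTerm 1 z n -
        (z ^ M / M - z ^ b / b)) (z ^ M / M - z ^ b / b)
      rw [sub_add_cancel] at this
      have e : (2 : ℝ) / b = 1 / b + 1 / b := by ring
      linarith
    rw [norm_mul] at h2
    have hp : 0 < ‖z - 1‖ := norm_pos_iff.2 hz1
    rw [div_right_comm, le_div_iff₀ hp]
    linarith
  · refine ⟨2, by norm_num, fun b M hb hM => ?_⟩
    have key : ‖∑ n ∈ Finset.Ico b M, cycloTerm j z n‖ ≤ 2 * (1 / (b : ℝ) - 1 / (M : ℝ)) := by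
      induction M, hM using Nat.le_induction with
      | base => simp
      | succ M hM ih =>
        rw [Finset.sum_Ico_succ_top hM]
        refine (norm_add_le _ _).trans ?_
        have h1 : (1 : ℝ) ≤ M := by exact_mod_cast hb.trans hM
        have : ‖cycloTerm j z M‖ ≤ 1 / (M : ℝ) ^ 2 := by
          simp only [cycloTerm, norm_div, norm_zpow, hz, one_zpow, norm_pow, Int.cast_natCast,
            Complex.norm_natCast]
          gcongr
          omega
        have := one_div_sq_le (hb.trans hM)
        linarith
    have : 0 ≤ 1 / (M : ℝ) := by positivity
    have e : (2 : ℝ) / b = 2 * (1 / b) := by ring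
    linarith

theorem cycloSum_eq_sum_Ico (j : ℕ) (z : ℂ) (N : ℕ) :
    cycloSum j z N = ∑ n ∈ Finset.Ico 1 (N + 1), cycloTerm j z n := by
  rw [cycloSum_eq]
  congr 1

theorem tendsto_cycloSum {j : ℕ} (hj : 1 ≤ j) {z : ℂ} (hz : ‖z‖ = 1) (hjz : ¬(j = 1 ∧ z = 1)) :
    Tendsto (cycloSum j z) atTop (𝓝 (cycloLi j z)) := by
  obtain ⟨C, hC, h⟩ := exists_norm_sum_Ico_cycloTerm_le hj hz hjz
  have h' : ∀ N n : ℕ, N ≤ n → dist (cycloSum j z n) (cycloSum j z N) ≤ C / ((N + 1 : ℕ) : ℝ) := by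
    intro N n hn
    rw [dist_eq_norm, cycloSum_eq_sum_Ico, cycloSum_eq_sum_Ico,
      ← Finset.sum_Ico_consecutive _ (by omega : 1 ≤ N + 1) (by omega : N + 1 ≤ n + 1),
      add_sub_cancel_left]
    exact h _ _ (by omega) (by omega)
  have hlim : Tendsto (fun N : ℕ => 2 * (C / ((N + 1 : ℕ) : ℝ))) atTop (𝓝 0) := by
    have := (tendsto_const_div_atTop_nhds_zero_nat C).comp (tendsto_add_atTop_nat 1)
    simpa using this.const_mul 2
  refine (cauchySeq_of_le_tendsto_0 _ (fun n m N hn hm => ?_) hlim).tendsto_limUnder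
  have := dist_triangle_right (cycloSum j z n) (cycloSum j z m) (cycloSum j z N)
  linarith [h' N n hn, h' N m hm]

/-- The tails `ρ b = ∑_{n ≥ b} z ^ n / n ^ j` exist and are `O(1 / b)`. -/
theorem exists_cycloTerm_tail {j : ℕ} (hj : 1 ≤ j) {z : ℂ} (hz : ‖z‖ = 1)
    (hjz : ¬(j = 1 ∧ z = 1)) :
    ∃ (ρ : ℕ → ℂ) (C : ℝ), 0 ≤ C ∧ ρ 1 = cycloLi j z ∧
      (∀ b : ℕ, 1 ≤ b → cycloTerm j z b = ρ b - ρ (b + 1)) ∧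
      ∀ b : ℕ, 1 ≤ b → ‖ρ b‖ ≤ C / b := by
  obtain ⟨C, hC, h⟩ := exists_norm_sum_Ico_cycloTerm_le hj hz hjz
  refine ⟨fun b => cycloLi j z - ∑ n ∈ Finset.Ico 1 b, cycloTerm j z n, C, hC, by simp, ?_, ?_⟩
  · intro b hb
    dsimp only
    rw [Finset.sum_Ico_succ_top hb]
    ring
  · intro b hb
    refine le_of_tendsto ((tendsto_cycloSum hj hz hjz).sub_const _).norm ?_
    filter_upwards [eventually_ge_atTop b] with N hN
    rw [cycloSum_eq_sum_Ico, ← Finset.sum_Ico_consecutive _ hb (by omega : b ≤ N + 1),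
      add_sub_cancel_left]
    exact h _ _ hb (by omega)

/-! ### Abel summation against the windows -/

/-- Abel summation: differences move from the tails `ρ` to `G`, so conditionally convergent series
can be estimated by absolute values. -/
theorem sum_Icc_mul_eq_of_sub {R : Type*} [CommRing R] {f ρ : ℕ → R}
    (h : ∀ b, 1 ≤ b → f b = ρ b - ρ (b + 1)) (G : ℕ → R) (M : ℕ) :
    ∑ b ∈ Finset.Icc 1 M, f b * G b =
      ρ 1 * G 0 + ∑ b ∈ Finset.Icc 1 M, ρ b * (G b - G (b - 1)) - ρ (M + 1) * G M := by
  induction M with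
  | zero => simp
  | succ M ih =>
    rw [Finset.sum_Icc_succ_top (by omega), Finset.sum_Icc_succ_top (by omega), ih, h _ (by omega),
      Nat.add_sub_cancel]
    ring

theorem cycloWindow_zero {l : ℕ} (hl : l ≠ 0) (z : ℂ) (N : ℕ) :
    cycloWindow l z N 0 = (-1) ^ l * cycloSum l z⁻¹ N + cycloSum l z N := by
  simp only [cycloWindow, Nat.cast_zero, zero_sub]
  rw [sum_Icc_neg_eq (cycloTerm_zero hl z), cycloSum_eq, cycloSum_eq, Finset.mul_sum]
  simp only [cycloTerm_neg]
  ring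

theorem cycloWindow_two_mul (l : ℕ) (z : ℂ) (N : ℕ) :
    cycloWindow l z N (2 * N) = cycloTerm l z N := by
  have : ((2 * N : ℕ) : ℤ) - N = N := by omega
  rw [cycloWindow, this, Finset.Icc_self, Finset.sum_singleton]

theorem cycloWindow_sub {l : ℕ} {z : ℂ} {N b : ℕ} (hb : b ∈ Finset.Icc 1 (2 * N)) :
    cycloWindow l z N b - cycloWindow l z N (b - 1) = -cycloTerm l z (b - (N + 1 : ℕ)) := by
  rw [Finset.mem_Icc] at hb
  have : Finset.Icc (((b - 1 : ℕ) : ℤ) - N) N =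
      insert ((b : ℤ) - (N + 1 : ℕ)) (Finset.Icc ((b : ℤ) - N) N) := by
    ext
    simp only [Finset.mem_insert, Finset.mem_Icc]
    omega
  rw [cycloWindow, cycloWindow, this, Finset.sum_insert]
  · ring
  · simp only [Finset.mem_Icc]
    omega

/-- The window at `b = 0` is symmetric. For `l = 1`, `z = 1` its two harmonic halves cancel for
every `N`, which accounts for the value `0`. -/
theorem tendsto_cycloWindow_zero {l : ℕ} (hl : 1 ≤ l) {z : ℂ} (hz : ‖z‖ = 1) :
    Tendsto (fun N => cycloWindow l z N 0) atTop (𝓝 (cycloBracket l z)) := by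
  have hl0 : l ≠ 0 := by omega
  simp only [cycloWindow_zero hl0, cycloBracket, if_neg hl0]
  split_ifs with h
  · obtain ⟨rfl, rfl⟩ := h
    simp
  · refine ((tendsto_cycloSum hl (by simp [hz]) ?_).const_mul _).add (tendsto_cycloSum hl hz h)
    simpa using h

/-- With `d = |b - (N+1)|`, `b + d ≥ N` gives `1/(b d) ≤ (1/b + 1/d) / N`. The sums of `1/b` and
`1/d` are at most one and two times the harmonic number `H (2N)`, and `H n / n` tends to `0` as a
Cesàro mean. -/
theorem tendsto_sum_one_div_mul_div :
    Tendsto (fun N : ℕ => ∑ b ∈ Finset.Icc 1 (2 * N),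
      1 / (b : ℝ) * (1 / |(b : ℝ) - (N + 1 : ℕ)|)) atTop (𝓝 0) := by
  have hH : Tendsto (fun N : ℕ => (N : ℝ)⁻¹ * ∑ i ∈ Finset.range N, 1 / ((i : ℝ) + 1)) atTop (𝓝 0) :=
    (tendsto_one_div_add_atTop_nhds_zero_nat (𝕜 := ℝ)).cesaro
  -- The factor `6` turns the bound `3 H(2N) / N` into a multiple of `H(2N) / (2N)`.
  have hH2 := (hH.comp (tendsto_id.const_mul_atTop' (zero_lt_two' ℕ))).const_mul 6
  rw [mul_zero] at hH2
  refine squeeze_zero' (Eventually.of_forall fun N => Finset.sum_nonneg fun b _ => by positivity)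
    ?_ hH2
  filter_upwards [eventually_ge_atTop 1] with N hN
  have hN' : (0 : ℝ) < N := by exact_mod_cast hN
  set H : ℕ → ℝ := fun n => ∑ i ∈ Finset.range n, 1 / ((i : ℝ) + 1) with hHdef
  have hmono : H N ≤ H (2 * N) :=
    Finset.sum_le_sum_of_subset_of_nonneg (by simp; omega) fun _ _ _ => by positivity
  have h1 : ∀ b ∈ Finset.Icc 1 (2 * N), 1 / (b : ℝ) * (1 / |(b : ℝ) - (N + 1 : ℕ)|) ≤
      (N : ℝ)⁻¹ * (1 / (b : ℝ) + 1 / |(b : ℝ) - (N + 1 : ℕ)|) := by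
    intro b hb
    rw [Finset.mem_Icc] at hb
    have hb' : (0 : ℝ) < b := by exact_mod_cast hb.1
    -- Here `d = 0`, and `1 / 0 = 0` matches the vanishing of the general term at `0`.
    rcases eq_or_ne b (N + 1) with rfl | hne
    · simp only [sub_self, abs_zero, div_zero, mul_zero, add_zero]
      positivity
    have hd : 0 < |(b : ℝ) - (N + 1 : ℕ)| := abs_pos.2 (sub_ne_zero.2 (by exact_mod_cast hne))
    have hle : (N : ℝ) ≤ b + |(b : ℝ) - (N + 1 : ℕ)| := by
      have := neg_le_abs ((b : ℝ) - (N + 1 : ℕ))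
      push_cast at this ⊢
      linarith
    set d := |(b : ℝ) - (N + 1 : ℕ)|
    have : (N : ℝ)⁻¹ * (1 / (b : ℝ) + 1 / d) = (b + d) / N * (1 / (b : ℝ) * (1 / d)) := by
      field_simp
      ring
    rw [this]
    exact le_mul_of_one_le_left (by positivity) ((one_le_div hN').2 hle)
  have hIcc : ∀ g : ℕ → ℝ, ∑ b ∈ Finset.Icc 1 (2 * N), g b = ∑ i ∈ Finset.range (2 * N), g (i + 1) := by
    intro g
    rw [Finset.range_eq_Ico, Finset.sum_Ico_add']
    congr 1
  have h2 : ∑ b ∈ Finset.Icc 1 (2 * N), 1 / (b : ℝ) = H (2 * N) := by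
    rw [hIcc]
    simp [hHdef]
  have h3 : ∑ b ∈ Finset.Icc 1 (2 * N), 1 / |(b : ℝ) - (N + 1 : ℕ)| ≤ 2 * H (2 * N) := by
    rw [hIcc, two_mul N, Finset.sum_range_add, ← two_mul N]
    have e1 : ∑ i ∈ Finset.range N, 1 / |((i + 1 : ℕ) : ℝ) - (N + 1 : ℕ)| = H N := by
      rw [hHdef, ← Finset.sum_range_reflect]
      refine Finset.sum_congr rfl fun i hi => ?_
      rw [Finset.mem_range] at hi
      have : ((N - 1 - i + 1 : ℕ) : ℝ) - (N + 1 : ℕ) = -((i + 1 : ℕ) : ℝ) := by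
        rw [sub_eq_iff_eq_add, neg_add_eq_sub, eq_sub_iff_add_eq]
        exact_mod_cast (by omega : N - 1 - i + 1 + (i + 1) = N + 1)
      rw [this, abs_neg, Nat.abs_cast]
      push_cast
      rfl
    have e2 : ∑ i ∈ Finset.range N, 1 / |((N + i + 1 : ℕ) : ℝ) - (N + 1 : ℕ)| ≤ H N := by
      have : ∀ i : ℕ, 1 / |((N + i + 1 : ℕ) : ℝ) - (N + 1 : ℕ)| = 1 / (i : ℝ) := by
        intro i
        push_cast
        rw [show (N : ℝ) + i + 1 - (N + 1) = i by ring, Nat.abs_cast]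
      simp only [this]
      obtain ⟨M, rfl⟩ : ∃ M, N = M + 1 := ⟨N - 1, by omega⟩
      rw [Finset.sum_range_succ']
      simp only [Nat.cast_zero, div_zero, add_zero, hHdef]
      push_cast
      exact Finset.sum_le_sum_of_subset_of_nonneg (by simp) fun _ _ _ => by positivity
    linarith
  refine (Finset.sum_le_sum h1).trans ?_
  rw [← Finset.mul_sum, Finset.sum_add_distrib, h2]
  have hHn : 0 ≤ H (2 * N) := Finset.sum_nonneg fun _ _ => by positivity
  simp only [Function.comp, id]
  change _ ≤ 6 * (((2 * N : ℕ) : ℝ)⁻¹ * H (2 * N))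
  have : 6 * (((2 * N : ℕ) : ℝ)⁻¹ * H (2 * N)) = (N : ℝ)⁻¹ * (3 * H (2 * N)) := by
    push_cast
    field_simp
    ring
  rw [this]
  gcongr
  linarith

/-- After Abel summation the main term is the full series times the window at `b = 0`. Raising `b`
by one drops a single window point, of size at most `1/|b - (N+1)|`, while the tail is `O(1/b)`, so
the rest is `tendsto_sum_one_div_mul_div`. -/
theorem tendsto_sum_cycloTerm_mul_cycloWindow {j l : ℕ} (hj : 1 ≤ j) (hl : 1 ≤ l) {u z : ℂ}
    (hu : ‖u‖ = 1) (hz : ‖z‖ = 1) (hju : ¬(j = 1 ∧ u = 1)) :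
    Tendsto (fun N : ℕ => ∑ b ∈ Finset.Icc 1 (2 * N), cycloTerm j u b * cycloWindow l z N b) atTop
      (𝓝 (cycloLi j u * cycloBracket l z)) := by
  obtain ⟨ρ, C, hC, hρ1, hρ, hρC⟩ := exists_cycloTerm_tail hj hu hju
  have hl0 : l ≠ 0 := by omega
  have h1 : Tendsto (fun N : ℕ => ρ 1 * cycloWindow l z N 0) atTop
      (𝓝 (cycloLi j u * cycloBracket l z)) := by
    rw [hρ1]
    exact (tendsto_cycloWindow_zero hl hz).const_mul _
  have h2 : Tendsto (fun N : ℕ => ∑ b ∈ Finset.Icc 1 (2 * N),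
      ρ b * (cycloWindow l z N b - cycloWindow l z N (b - 1))) atTop (𝓝 0) := by
    have := tendsto_sum_one_div_mul_div.const_mul C
    rw [mul_zero] at this
    refine squeeze_zero_norm (fun N => ?_) this
    rw [Finset.mul_sum]
    refine norm_sum_le_of_le _ fun b hb => ?_
    rw [cycloWindow_sub hb, norm_mul, norm_neg, ← mul_assoc, mul_one_div C]
    have := norm_cycloTerm_le hl0 hz (b - (N + 1 : ℕ))
    push_cast at this ⊢
    exact mul_le_mul (hρC b (Finset.mem_Icc.1 hb).1) this (norm_nonneg _) (by positivity)
  have h3 : Tendsto (fun N : ℕ => ρ (2 * N + 1) * cycloWindow l z N (2 * N)) atTop (𝓝 0) := by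
    refine squeeze_zero_norm' ?_ (tendsto_const_div_atTop_nhds_zero_nat C)
    filter_upwards [eventually_ge_atTop 1] with N hN
    have hN' : (1 : ℝ) ≤ N := by exact_mod_cast hN
    rw [cycloWindow_two_mul, norm_mul]
    have a1 : ‖ρ (2 * N + 1)‖ ≤ C / N := by
      refine (hρC _ (by omega)).trans ?_
      gcongr
      omega
    have a2 : ‖cycloTerm l z N‖ ≤ 1 := by
      refine (norm_cycloTerm_le hl0 hz N).trans ?_
      simp only [Int.cast_natCast, Nat.abs_cast]
      exact (div_le_one (by linarith)).2 hN'
    exact (mul_le_of_le_one_right (norm_nonneg _) a2).trans a1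
  have := (h1.add h2).sub h3
  rw [add_zero, sub_zero] at this
  refine this.congr fun N => ?_
  rw [sum_Icc_mul_eq_of_sub hρ]

/-! ### Convergence of the double series -/

theorem cycloDoubleSum_eq (k₁ k₂ : ℕ) (x₁ x₂ : ℂ) (N : ℕ) :
    cycloDoubleSum k₁ k₂ x₁ x₂ N =
      ∑ n ∈ Finset.Icc 1 N, ∑ i ∈ Finset.Ico 1 n, cycloTerm k₁ x₁ i * cycloTerm k₂ x₂ n := by
  simp [cycloDoubleSum, cycloTerm, div_mul_div_comm]

/-- Abel summation with the tails of the outer series leaves terms `O(1 / b^2)`, an absolutely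
convergent series, and a boundary term that vanishes because the inner sums converge. -/
theorem tendsto_cycloDoubleSum {k q : ℕ} (hk : 1 ≤ k) (hq : 1 ≤ q) {x y : ℂ} (hx : ‖x‖ = 1)
    (hy : ‖y‖ = 1) (hqx : ¬(q = 1 ∧ x = 1)) (hky : ¬(k = 1 ∧ y = 1)) :
    Tendsto (cycloDoubleSum k q y x) atTop (𝓝 (cycloDoubleLi k q y x)) := by
  obtain ⟨ρ, C, hC, hρ1, hρ, hρC⟩ := exists_cycloTerm_tail hq hx hqx
  have hk0 : k ≠ 0 := by omega
  set G : ℕ → ℂ := fun n => ∑ i ∈ Finset.Ico 1 n, cycloTerm k y i with hG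
  have e : ∀ N, cycloDoubleSum k q y x N = ρ 1 * G 0 +
      ∑ b ∈ Finset.Icc 1 N, ρ b * (G b - G (b - 1)) - ρ (N + 1) * G N := by
    intro N
    rw [← sum_Icc_mul_eq_of_sub hρ, cycloDoubleSum_eq]
    refine Finset.sum_congr rfl fun n _ => ?_
    rw [← Finset.sum_mul, mul_comm]
  have hlast : Tendsto (fun N : ℕ => ρ (N + 1) * G N) atTop (𝓝 0) := by
    have hG' : Tendsto G atTop (𝓝 (cycloLi k y)) := by
      rw [← tendsto_add_atTop_iff_nat 1]
      exact (tendsto_cycloSum hk hy hky).congr fun N => cycloSum_eq_sum_Ico k y N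
    have hρ0 : Tendsto (fun N => ρ (N + 1)) atTop (𝓝 0) :=
      squeeze_zero_norm (fun N => hρC (N + 1) (by omega))
        ((tendsto_const_div_atTop_nhds_zero_nat C).comp (tendsto_add_atTop_nat 1))
    simpa using hρ0.mul hG'
  have hsum : Summable fun b : ℕ => ρ (b + 1) * (G (b + 1) - G b) := by
    have hs : Summable fun b : ℕ => C * (1 / (b : ℝ) ^ 2) :=
      (Real.summable_one_div_nat_pow.2 one_lt_two).mul_left C
    refine Summable.of_norm_bounded_eventually_nat hs ?_
    filter_upwards [eventually_ge_atTop 1] with b hb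
    have hb' : (0 : ℝ) < b := by exact_mod_cast hb
    have : G (b + 1) - G b = cycloTerm k y b := by
      simp only [hG]
      rw [Finset.sum_Ico_succ_top hb]
      ring
    rw [this, norm_mul]
    have a1 : ‖ρ (b + 1)‖ ≤ C / b := by
      refine (hρC _ (by omega)).trans ?_
      gcongr
      omega
    have a2 := norm_cycloTerm_le hk0 hy b
    rw [Int.cast_natCast, Nat.abs_cast] at a2
    calc _ ≤ C / b * (1 / b) := mul_le_mul a1 a2 (norm_nonneg _) (by positivity)
      _ = _ := by ring
  have hT := ((hsum.hasSum.tendsto_sum_nat).const_add (ρ 1 * G 0)).sub hlast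
  refine tendsto_nhds_limUnder ⟨_, hT.congr fun N => ?_⟩
  have h := Finset.sum_Ico_add' (fun b => ρ b * (G b - G (b - 1))) 0 N 1
  simp only [Nat.add_sub_cancel] at h
  rw [e, Finset.range_eq_Ico, h]
  rfl

/-! ### Comparison of the two evaluations -/

/-- Source of the factor `(-1)^l` in the second sum of the parity formula. -/
theorem cycloBracket_inv {l : ℕ} (hl : l ≠ 0) (z : ℂ) :
    cycloBracket l z⁻¹ = (-1) ^ l * cycloBracket l z := by
  simp only [cycloBracket, if_neg hl, inv_eq_one, inv_inv]
  split_ifs with h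
  · simp
  · rw [mul_add, ← mul_assoc, ← mul_pow]
    simp [add_comm]

/-- The term `l = 0`, where the bracket is `-1`, is the correction from an exceptional point; the
others are shifted by `l = i + 1`. The weight `c` is `1` for the first sum and `(-1)^l` for the
second. -/
theorem sum_range_choose_mul_cycloBracket (m p : ℕ) (z : ℂ) (c : ℕ → ℂ) (F : ℕ → ℂ) (hc : c 0 = 1) :
    ∑ l ∈ Finset.range (m + 1 + 1),
        c l * ((p + 1 + (m + 1) - l - 1).choose p : ℂ) * cycloBracket l z * F (p + 1 + (m + 1) - l) =
      ∑ ij ∈ Finset.HasAntidiagonal.antidiagonal m, ((p + ij.2).choose ij.2 : ℂ) *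
        (F (p + 1 + ij.2) * (c (ij.1 + 1) * cycloBracket (ij.1 + 1) z))
      - ((m + p + 1).choose p : ℂ) * F (m + p + 2) := by
  rw [Finset.sum_range_succ', Finset.Nat.sum_antidiagonal_eq_sum_range_succ_mk, sub_eq_add_neg]
  congr 1
  · refine Finset.sum_congr rfl fun l hl => ?_
    rw [Finset.mem_range] at hl
    have e1 : p + 1 + (m + 1) - (l + 1) - 1 = p + (m - l) := by omega
    have e2 : p + 1 + (m + 1) - (l + 1) = p + 1 + (m - l) := by omega
    rw [e1, e2, Nat.choose_symm_add]
    ring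
  · have e1 : p + 1 + (m + 1) - 0 - 1 = m + p + 1 := by omega
    have e2 : p + 1 + (m + 1) - 0 = m + p + 2 := by omega
    rw [e1, e2, hc]
    simp [cycloBracket]

theorem tendsto_sum_lt_cycloTerm {x y : ℂ} (hx : ‖x‖ = 1) (hy : ‖y‖ = 1) {q k : ℕ}
    (hq : 1 ≤ q) (hk : 1 ≤ k) (hqx : ¬(q = 1 ∧ x = 1)) (hky : ¬(k = 1 ∧ y = 1)) :
    Tendsto (fun N : ℕ => ∑ a ∈ Finset.Icc (-(N : ℤ)) N, ∑ c ∈ Finset.Ico (-(N : ℤ)) a,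
        cycloTerm k y a * cycloTerm q x c) atTop
      (𝓝 (cycloLi k y * cycloLi q x + cycloLi k y * ((-1) ^ q * cycloLi q x⁻¹)
        - cycloLi (k + q) (y * x) - cycloDoubleLi k q y x
        + (-1) ^ (k + q) * cycloDoubleLi k q y⁻¹ x⁻¹)) := by
  have hq0 : q ≠ 0 := by omega
  have hk0 : k ≠ 0 := by omega
  have hx' : ‖x⁻¹‖ = 1 := by simp [hx]
  have hy' : ‖y⁻¹‖ = 1 := by simp [hy]
  have hqx' : ¬(q = 1 ∧ x⁻¹ = 1) := by simpa using hqx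
  have hky' : ¬(k = 1 ∧ y⁻¹ = 1) := by simpa using hky
  have t1 := tendsto_cycloSum hk hy hky
  have t2 := tendsto_cycloSum hq hx hqx
  have t3 := (tendsto_cycloSum hq hx' hqx').const_mul ((-1) ^ q)
  have t4 := tendsto_cycloSum (j := k + q) (z := y * x) (by omega) (by simp [hx, hy]) (by omega)
  have t5 := tendsto_cycloDoubleSum hk hq hx hy hqx hky
  have t6 := (tendsto_cycloDoubleSum hk hq hx' hy' hqx' hky').const_mul ((-1) ^ (k + q))
  refine (((((t1.mul t2).add (t1.mul t3)).sub t4).sub t5).add t6).congr fun N => ?_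
  rw [sum_lt_Icc_neg_eq (cycloTerm_zero hk0 y) (cycloTerm_zero hq0 x)]
  have e : ∀ n : ℤ, cycloTerm k y n * cycloTerm q x n = cycloTerm (k + q) (y * x) n := by
    intro n
    simp only [cycloTerm, mul_zpow, pow_add, div_mul_div_comm]
  have e' : ∀ i n : ℤ, (-1) ^ k * cycloTerm k y⁻¹ i * ((-1) ^ q * cycloTerm q x⁻¹ n) =
      (-1) ^ (k + q) * (cycloTerm k y⁻¹ i * cycloTerm q x⁻¹ n) := by
    intro i n
    ring
  simp only [cycloTerm_neg, e, e', cycloSum_eq, cycloDoubleSum_eq, ← Finset.mul_sum]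

theorem parity_depth_two {x y : ℂ} (hx : ‖x‖ = 1) (hy : ‖y‖ = 1) (m p : ℕ)
    (hqx : ¬(p + 1 = 1 ∧ x = 1)) (hky : ¬(m + 1 = 1 ∧ y = 1)) :
    (-1) ^ (p + 1) * (cycloLi (m + 1) y * cycloLi (p + 1) x
        + cycloLi (m + 1) y * ((-1) ^ (p + 1) * cycloLi (p + 1) x⁻¹)
        - cycloLi (m + 1 + (p + 1)) (y * x) - cycloDoubleLi (m + 1) (p + 1) y x
        + (-1) ^ (m + 1 + (p + 1)) * cycloDoubleLi (m + 1) (p + 1) y⁻¹ x⁻¹) =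
      ∑ ij ∈ Finset.HasAntidiagonal.antidiagonal m, ((p + ij.2).choose ij.2 : ℂ) *
        (cycloLi (p + 1 + ij.2) x⁻¹ * cycloBracket (ij.1 + 1) (x * y)) +
      ∑ ij ∈ Finset.HasAntidiagonal.antidiagonal p, ((m + ij.2).choose ij.2 : ℂ) *
        (cycloLi (m + 1 + ij.2) y * cycloBracket (ij.1 + 1) (x * y)⁻¹)
      - ((m + p + 1).choose p : ℂ) * cycloLi (m + p + 2) x⁻¹
      - ((m + p + 1).choose m : ℂ) * cycloLi (m + p + 2) y := by
  have hx0 : x ≠ 0 := norm_ne_zero_iff.1 (by simp [hx])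
  have hy0 : y ≠ 0 := norm_ne_zero_iff.1 (by simp [hy])
  have hx' : ‖x⁻¹‖ = 1 := by simp [hx]
  have hz : ‖x * y‖ = 1 := by simp [hx, hy]
  have hz' : ‖(x * y)⁻¹‖ = 1 := by rw [norm_inv, hz, inv_one]
  have h1 := (tendsto_sum_lt_cycloTerm hx hy (by omega) (by omega) hqx hky).const_mul
    ((-1) ^ (p + 1))
  simp only [sum_lt_cycloTerm_eq_sum_window hx0 hy0] at h1
  refine tendsto_nhds_unique h1 (((Tendsto.add ?_ ?_).sub ?_).sub ?_)
  · refine tendsto_finsetSum _ fun ij _ => Tendsto.const_mul _ ?_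
    refine tendsto_sum_cycloTerm_mul_cycloWindow (by omega) (by omega) hx' hz fun h => hqx ?_
    exact ⟨by omega, by simpa using h.2⟩
  · refine tendsto_finsetSum _ fun ij _ => Tendsto.const_mul _ ?_
    refine tendsto_sum_cycloTerm_mul_cycloWindow (by omega) (by omega) hy hz' fun h => hky ?_
    exact ⟨by omega, h.2⟩
  · exact (tendsto_cycloSum (by omega) hx' (by omega)).const_mul _
  · exact (tendsto_cycloSum (by omega) hy (by omega)).const_mul _

theorem norm_eq_one_of_exists_pow_eq_one {z : ℂ} (hz : ∃ n : ℕ, 0 < n ∧ z ^ n = 1) : ‖z‖ = 1 := by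
  obtain ⟨n, hn, h⟩ := hz
  exact Complex.norm_eq_one_of_pow_eq_one h hn.ne'

theorem corollary4p2 (x y : ℂ)
    (hx : ∃ n : ℕ, 0 < n ∧ x ^ n = 1) (hy : ∃ n : ℕ, 0 < n ∧ y ^ n = 1)
    (q k : ℕ) (hq : 1 ≤ q) (hk : 1 ≤ k)
    (hqx : ¬(q = 1 ∧ x = 1)) (hky : ¬(k = 1 ∧ y = 1)) :
    -- all the values that occur are limits of convergent series
    (∀ (j : ℕ) (z : ℂ), 1 ≤ j → (∃ n : ℕ, 0 < n ∧ z ^ n = 1) → ¬(j = 1 ∧ z = 1) →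
      Tendsto (cycloSum j z) atTop (𝓝 (cycloLi j z))) ∧
    Tendsto (cycloDoubleSum k q y x) atTop (𝓝 (cycloDoubleLi k q y x)) ∧
    Tendsto (cycloDoubleSum k q y⁻¹ x⁻¹) atTop (𝓝 (cycloDoubleLi k q y⁻¹ x⁻¹)) ∧
    -- the parity formula
    cycloDoubleLi k q y x - (-1) ^ (q + k) * cycloDoubleLi k q y⁻¹ x⁻¹ =
      cycloLi q x * cycloLi k y + (-1) ^ q * cycloLi k y * cycloLi q x⁻¹
        - cycloLi (k + q) (x * y)
        - (-1) ^ q * ∑ l ∈ Finset.range (k + 1),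
            ((q + k - l - 1).choose (q - 1) : ℂ) * cycloBracket l (x * y)
              * cycloLi (q + k - l) x⁻¹
        - (-1) ^ q * ∑ l ∈ Finset.range (q + 1),
            (-1) ^ l * ((q + k - l - 1).choose (k - 1) : ℂ) * cycloBracket l (x * y)
              * cycloLi (q + k - l) y := by
  have hx1 := norm_eq_one_of_exists_pow_eq_one hx
  have hy1 := norm_eq_one_of_exists_pow_eq_one hy
  refine ⟨fun j z hj hz hjz => tendsto_cycloSum hj (norm_eq_one_of_exists_pow_eq_one hz) hjz,
    tendsto_cycloDoubleSum hk hq hx1 hy1 hqx hky,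
    tendsto_cycloDoubleSum hk hq (by simp [hx1]) (by simp [hy1]) (by simpa using hqx)
      (by simpa using hky), ?_⟩
  obtain ⟨p, rfl⟩ : ∃ p, q = p + 1 := ⟨q - 1, by omega⟩
  obtain ⟨m, rfl⟩ : ∃ m, k = m + 1 := ⟨k - 1, by omega⟩
  have key := parity_depth_two hx1 hy1 m p hqx hky
  have s1 := sum_range_choose_mul_cycloBracket m p (x * y) (fun _ => 1) (fun j => cycloLi j x⁻¹) rfl
  have s2 := sum_range_choose_mul_cycloBracket p m (x * y) (fun l => (-1) ^ l)
    (fun j => cycloLi j y) (pow_zero _)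
  simp only [one_mul] at s1
  simp only [← cycloBracket_inv (Nat.succ_ne_zero _), add_comm (m + 1) (p + 1), add_comm p m] at s2
  simp only [add_comm (m + 1) (p + 1), mul_comm y x] at key
  rw [add_comm (m + 1) (p + 1), Nat.add_sub_cancel, Nat.add_sub_cancel, s1, s2]
  have hsq : ((-1 : ℂ) ^ (p + 1)) * (-1) ^ (p + 1) = 1 := by rw [← mul_pow]; simp
  -- Multiplying by `(-1)^q` once more clears the sign in front of the sign-split evaluation, by
  -- `hsq`.
  linear_combination (-(-1 : ℂ) ^ (p + 1)) * key + (cycloLi (m + 1) y * cycloLi (p + 1) x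
        + cycloLi (m + 1) y * ((-1) ^ (p + 1) * cycloLi (p + 1) x⁻¹)
        - cycloLi (p + 1 + (m + 1)) (x * y) - cycloDoubleLi (m + 1) (p + 1) y x
        + (-1) ^ (p + 1 + (m + 1)) * cycloDoubleLi (m + 1) (p + 1) y⁻¹ x⁻¹) * hsq
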